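/- All graphs are finite, simple and undirected. A \emph{cut} in a graph $G=(V,E)$ is the set of all edges of $G$ between $X$ and $V\setminus X$ for some $X\subseteq V$. A mapping $f:E(G)\to E(G')$ is \emph{cut-continuous} if $f^{-1}(C)$ is a cut in $G$ for every cut $C$ in $G'$. Write $G\preccurlyeq_{cc}G'$ if there is a cut-continuous mapping from $E(G)$ to $E(G')$, and $G\prec_{cc}G'$ if $G\preccurlyeq_{cc}G'$ but not $G'\preccurlyeq_{cc}G$. Every countable partial order can be represented by finite graphs with the relation $\prec_{cc}$: for every countable partially ordered set $(P,\le)$ there are finite graphs $G_p$ $(p\in P)$ such that for all $p,q\in P$ $$p<q\iff G_p\prec_{cc}G_q\qquad\text{and}\qquad p\le q\iff G_p\preccurlyeq_{cc}G_q .$$ (In particular, $G_p$ and $G_q$ are not cut-continuously equivalent when $p\ne q$.) -/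

import Mathlib

/-- A set `C` of edges of `G` is a *cut* if, for some set `X` of vertices, `C` consists of exactly
the edges of `G` with one end in `X` and the other end outside `X`. -/
def SimpleGraph.IsEdgeCut {V : Type*} (G : SimpleGraph V) (C : Set G.edgeSet) : Prop :=
  ∃ X : Set V, C = {e : G.edgeSet | ∃ u ∈ X, ∃ v ∉ X, (e : Sym2 V) = s(u, v)}

/-- A map between edge sets is *cut-continuous* if the preimage of every cut is a cut. -/
def SimpleGraph.IsCutContinuous {V W : Type*} (G : SimpleGraph V) (H : SimpleGraph W)
    (f : G.edgeSet → H.edgeSet) : Prop :=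
  ∀ C : Set H.edgeSet, H.IsEdgeCut C → G.IsEdgeCut (f ⁻¹' C)

/-- The cut-continuous quasiorder: there is a cut-continuous map from `G` to `H`. -/
def SimpleGraph.CutLE {V W : Type*} (G : SimpleGraph V) (H : SimpleGraph W) : Prop :=
  ∃ f : G.edgeSet → H.edgeSet, G.IsCutContinuous H f

/-- The strict cut-continuous order. -/
def SimpleGraph.CutLT {V W : Type*} (G : SimpleGraph V) (H : SimpleGraph W) : Prop :=
  G.CutLE H ∧ ¬ H.CutLE G

infix:50 " ≼cc " => SimpleGraph.CutLE
infix:50 " ≺cc " => SimpleGraph.CutLT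

/-! Cut-continuous maps reduce to homomorphisms, and homomorphisms to divisibility. Pulling back the
stars of single vertices turns a cut-continuous map into a set-valued vertex map
(`CutLE.exists_symmDiff`). On a 5-clique its values are singleton perturbations of one set
(`exists_center`). Overlapping 5-cliques share that centre, so the perturbing points give a
homomorphism (`CutLE.nonempty_hom`). In `jumpCycle n` the distances 1 to 4 supply the 5-cliques. The
distance 10 forces every homomorphism to wind around with constant step `±1`, so lengths compare by
divisibility. Disjoint unions then realise domination of finite sets of numbers under divisibility,
and this order contains every countable partial order. -/

set_option synthInstance.maxHeartbeats 400000 in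
set_option synthInstance.maxSize 4000 in
set_option maxRecDepth 10000 in
/-- A sequence of integers all of whose differences at distances `1, 2, 3, 4, 10` lie in
`{±1, ±2, ±3, ±4, ±10}` starts with two equal steps `±1`. -/
theorem steps_eq_of_sums_mem :
    ∀ L : List ℤ, L = [-10, -4, -3, -2, -1, 1, 2, 3, 4, 10] →
    ∀ a ∈ L, ∀ b ∈ L, a + b ∈ L → ∀ c ∈ L, b + c ∈ L → a + b + c ∈ L →
    ∀ d ∈ L, c + d ∈ L → b + c + d ∈ L → a + b + c + d ∈ L →
    ∀ e ∈ L, d + e ∈ L → c + d + e ∈ L → b + c + d + e ∈ L →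
    ∀ f ∈ L, e + f ∈ L → d + e + f ∈ L → c + d + e + f ∈ L →
    ∀ g ∈ L, f + g ∈ L → e + f + g ∈ L → d + e + f + g ∈ L →
    ∀ h ∈ L, g + h ∈ L → f + g + h ∈ L → e + f + g + h ∈ L →
    ∀ i ∈ L, h + i ∈ L → g + h + i ∈ L → f + g + h + i ∈ L →
    ∀ j ∈ L, i + j ∈ L → h + i + j ∈ L → g + h + i + j ∈ L →
      a + b + c + d + e + f + g + h + i + j ∈ L → a = b ∧ (a = 1 ∨ a = -1) := by
  rintro L rfl
  -- Each sum condition stands right after the last step it involves, so the finite search is pruned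
  -- early. The ten-step sum excludes, for instance, folding onto five vertices, where it would be
  -- 0.
  decide +kernel

/-! ### Cut-continuous maps and sets differing in two elements -/

namespace SimpleGraph

variable {U V W : Type*} {F : SimpleGraph U} {G : SimpleGraph V} {H : SimpleGraph W}

theorem CutLE.trans (h₁ : F ≼cc G) (h₂ : G ≼cc H) : F ≼cc H := by
  obtain ⟨f, hf⟩ := h₁
  obtain ⟨g, hg⟩ := h₂
  exact ⟨g ∘ f, fun C hC => hf _ (hg _ hC)⟩

theorem Hom.cutLE (φ : G →g H) : G ≼cc H := by
  refine ⟨φ.mapEdgeSet, ?_⟩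
  rintro _ ⟨X, rfl⟩
  refine ⟨φ ⁻¹' X, ?_⟩
  ext ⟨e, he⟩
  induction e with | _ u v
  simp only [Set.mem_preimage, Set.mem_ofPred_eq, Hom.mapEdgeSet, Sym2.map_mk, Sym2.eq_iff]
  constructor
  · rintro ⟨a, ha, b, hb, ⟨rfl, rfl⟩ | ⟨rfl, rfl⟩⟩
    · exact ⟨u, ha, v, hb, Or.inl ⟨rfl, rfl⟩⟩
    · exact ⟨v, ha, u, hb, Or.inr ⟨rfl, rfl⟩⟩
  · rintro ⟨a, ha, b, hb, ⟨rfl, rfl⟩ | ⟨rfl, rfl⟩⟩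
    · exact ⟨_, ha, _, hb, Or.inl ⟨rfl, rfl⟩⟩
    · exact ⟨_, ha, _, hb, Or.inr ⟨rfl, rfl⟩⟩

/-- A cut-continuous map lifts to a map from vertices to sets of vertices, under which adjacent
vertices go to sets that differ exactly in the two ends of an edge. -/
theorem CutLE.exists_symmDiff (h : G ≼cc H) :
    ∃ g : V → Set W, ∀ u v, G.Adj u v → ∃ a b, H.Adj a b ∧ symmDiff (g u) (g v) = {a, b} := by
  obtain ⟨f, hf⟩ := h
  -- `X c` is one side of the preimage of the star at `c`; an edge crosses it iff its image is
  -- incident with `c`.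
  choose X hX using fun c : W => hf _ ⟨{c}, rfl⟩
  refine ⟨fun u => {c | u ∈ X c}, fun u v huv => ?_⟩
  obtain ⟨e, he⟩ : ∃ e, f ⟨s(u, v), huv⟩ = e := ⟨_, rfl⟩
  obtain ⟨e, hab⟩ := e
  induction e with | _ a b
  refine ⟨a, b, hab, ?_⟩
  have hne : a ≠ b := H.ne_of_adj hab
  ext c
  have key := Set.ext_iff.1 (hX c) ⟨s(u, v), huv⟩
  simp only [Set.mem_preimage, he, Set.mem_ofPred_eq, Set.mem_singleton_iff, Sym2.eq_iff] at key
  simp only [Set.mem_symmDiff, Set.mem_ofPred_eq, Set.mem_insert_iff, Set.mem_singleton_iff]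
  constructor
  · intro h
    have : ∃ u_1 ∈ X c, ∃ v_1 ∉ X c, u = u_1 ∧ v = v_1 ∨ u = v_1 ∧ v = u_1 := by
      rcases h with ⟨h, h'⟩ | ⟨h, h'⟩
      · exact ⟨u, h, v, h', Or.inl ⟨rfl, rfl⟩⟩
      · exact ⟨v, h, u, h', Or.inr ⟨rfl, rfl⟩⟩
    obtain ⟨_, rfl, _, _, ⟨rfl, _⟩ | ⟨_, rfl⟩⟩ := key.2 this
    · exact Or.inl rfl
    · exact Or.inr rfl
  · intro h
    have : ∃ u, u = c ∧ ∃ v, ¬v = c ∧ (a = u ∧ b = v ∨ a = v ∧ b = u) := by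
      rcases h with rfl | rfl
      · exact ⟨_, rfl, b, hne.symm, Or.inl ⟨rfl, rfl⟩⟩
      · exact ⟨_, rfl, a, hne, Or.inr ⟨rfl, rfl⟩⟩
    obtain ⟨_, h₁, _, h₂, ⟨rfl, rfl⟩ | ⟨rfl, rfl⟩⟩ := key.1 this
    · exact Or.inl ⟨h₁, h₂⟩
    · exact Or.inr ⟨h₁, h₂⟩

/-- Two sets that differ in exactly two elements. -/
def DifferInTwo (A B : Set W) : Prop := ∃ a b, a ≠ b ∧ symmDiff A B = {a, b}

/-- Disjoint pairs differ in four elements and equal pairs in none, so exactly one element is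
shared. -/
theorem pair_meet {a b c d : W} (hab : a ≠ b) (hcd : c ≠ d)
    (h : DifferInTwo ({a, b} : Set W) {c, d}) :
    ∃ z x y, x ≠ y ∧ x ≠ z ∧ y ≠ z ∧ ({a, b} : Set W) = {z, x} ∧ ({c, d} : Set W) = {z, y} := by
  obtain ⟨e, f, hef, h⟩ := h
  have h' : ∀ x, _ ↔ _ := Set.ext_iff.1 h
  simp only [Set.mem_symmDiff, Set.mem_insert_iff, Set.mem_singleton_iff] at h'
  by_cases hac : a = c
  · subst hac
    exact ⟨a, b, d, by rintro rfl; have := h' e; simp at this; grind, hab.symm, hcd.symm, rfl, rfl⟩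
  by_cases had : a = d
  · subst had
    exact ⟨a, b, c, by grind, hab.symm, hcd, rfl, Set.pair_comm _ _⟩
  by_cases hbc : b = c
  · subst hbc
    exact ⟨b, a, d, by grind, hab, hcd.symm, Set.pair_comm _ _, rfl⟩
  by_cases hbd : b = d
  · subst hbd
    exact ⟨b, a, c, by grind, hab, hcd, Set.pair_comm _ _, Set.pair_comm _ _⟩
  have h1 := h' a
  have h2 := h' b
  have h3 := h' c
  grind

/-- Five sets that pairwise differ in two elements are singleton perturbations of one set. -/
theorem exists_center {A B C D E : Set W}
    (hAB : DifferInTwo A B) (hAC : DifferInTwo A C) (hAD : DifferInTwo A D) (hAE : DifferInTwo A E)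
    (hBC : DifferInTwo B C) (hBD : DifferInTwo B D) (hBE : DifferInTwo B E)
    (hCD : DifferInTwo C D) (hCE : DifferInTwo C E) (hDE : DifferInTwo D E) :
    ∃ Z : Set W, ∀ S, (S = A ∨ S = B ∨ S = C ∨ S = D ∨ S = E) → ∃ x, S = symmDiff Z {x} := by
  have trans {X Y : Set W} (h : DifferInTwo X Y) :
      DifferInTwo (symmDiff A X) (symmDiff A Y) := by
    obtain ⟨a, b, hab, h⟩ := h
    exact ⟨a, b, hab, by rw [← h, symmDiff_symmDiff_symmDiff_comm]; simp⟩
  have back {X Y : Set W} (h : symmDiff A X = Y) : X = symmDiff A Y := by rw [← h]; simp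
  have hBC' := trans hBC
  have hBD' := trans hBD
  have hBE' := trans hBE
  have hCD' := trans hCD
  have hCE' := trans hCE
  have hDE' := trans hDE
  obtain ⟨b, b', hb, hB⟩ := hAB
  obtain ⟨c, c', hc, hC⟩ := hAC
  obtain ⟨d, d', hd, hD⟩ := hAD
  obtain ⟨e, e', he, hE⟩ := hAE
  rw [hB, hC] at hBC'
  obtain ⟨z, x, y, hxy, hxz, hyz, h1, h2⟩ := pair_meet hb hc hBC'
  rw [h1] at hB
  rw [h2] at hC
  -- After translation by `A`, a pair meeting both `{z, x}` and `{z, y}` contains `z` or closes the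
  -- triangle. With two further sets the triangle is impossible; four sets in all would not suffice.
  have third {S : Set W} {u v : W} (huv : u ≠ v) (hS : symmDiff A S = {u, v})
      (hBS : DifferInTwo (symmDiff A B) (symmDiff A S))
      (hCS : DifferInTwo (symmDiff A C) (symmDiff A S)) :
      (∃ w, w ≠ x ∧ w ≠ y ∧ w ≠ z ∧ symmDiff A S = {z, w}) ∨ symmDiff A S = {x, y} := by
    rw [hB, hS] at hBS
    rw [hC, hS] at hCS
    obtain ⟨p, q, r, hqr, hqp, hrp, h3, h4⟩ := pair_meet hxz.symm huv hBS
    obtain ⟨p', q', r', hqr', hqp', hrp', h5, h6⟩ := pair_meet hyz.symm huv hCS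
    rw [hS, h4]
    rw [h4] at h6
    simp only [Set.pair_eq_pair_iff] at h3 h5 h6 ⊢
    by_cases hz : p = z
    · exact Or.inl ⟨r, by grind⟩
    · by_cases hz' : r = z
      · exact Or.inl ⟨p, by grind⟩
      · exact Or.inr (by grind)
  have not_both {S T : Set W} {w : W} (hw : w ≠ x ∧ w ≠ y ∧ w ≠ z) (hS : symmDiff A S = {z, w})
      (hT : symmDiff A T = {x, y}) (hST : DifferInTwo (symmDiff A S) (symmDiff A T)) : False := by
    rw [hS, hT] at hST
    obtain ⟨p, q, r, hqr, hqp, hrp, h3, h4⟩ := pair_meet hw.2.2.symm hxy hST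
    simp only [Set.pair_eq_pair_iff] at h3 h4
    grind
  have single {S : Set W} {w : W} (hwz : w ≠ z) (hS : symmDiff A S = {z, w}) :
      S = symmDiff (symmDiff A {z}) {w} := by
    rw [symmDiff_assoc, back hS]
    congr 1
    ext t
    simp only [Set.mem_symmDiff, Set.mem_insert_iff, Set.mem_singleton_iff]
    grind
  have hDE_ne : symmDiff A D ≠ symmDiff A E := by
    intro h
    obtain ⟨p, q, _, h'⟩ := hDE'
    rw [h, symmDiff_self] at h'
    exact (Set.insert_nonempty p {q}).ne_empty h'.symm
  have hDE_comm : DifferInTwo (symmDiff A E) (symmDiff A D) := by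
    rwa [DifferInTwo, symmDiff_comm]
  refine ⟨symmDiff A {z}, ?_⟩
  rcases third hd hD hBD' hCD' with ⟨d₁, hd₁, hd₂, hd₃, hD₁⟩ | hD₁ <;>
  rcases third he hE hBE' hCE' with ⟨e₁, he₁, he₂, he₃, hE₁⟩ | hE₁
  · rintro S (rfl | rfl | rfl | rfl | rfl)
    · exact ⟨z, by simp⟩
    · exact ⟨x, single hxz hB⟩
    · exact ⟨y, single hyz hC⟩
    · exact ⟨d₁, single hd₃ hD₁⟩
    · exact ⟨e₁, single he₃ hE₁⟩
  · exact (not_both ⟨hd₁, hd₂, hd₃⟩ hD₁ hE₁ hDE').elim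
  · exact (not_both ⟨he₁, he₂, he₃⟩ hE₁ hD₁ hDE_comm).elim
  · exact (hDE_ne (hD₁.trans hE₁.symm)).elim

/-- Each element is toggled in at most one of the three sets, so the centre is their elementwise
majority. -/
theorem center_unique {A B C Z Z' : Set W} (hAB : A ≠ B) (hAC : A ≠ C) (hBC : B ≠ C)
    (hA : ∃ x, A = symmDiff Z {x}) (hB : ∃ x, B = symmDiff Z {x}) (hC : ∃ x, C = symmDiff Z {x})
    (hA' : ∃ x, A = symmDiff Z' {x}) (hB' : ∃ x, B = symmDiff Z' {x})
    (hC' : ∃ x, C = symmDiff Z' {x}) : Z = Z' := by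
  have key : ∀ Y : Set W, (∃ x, A = symmDiff Y {x}) → (∃ x, B = symmDiff Y {x}) →
      (∃ x, C = symmDiff Y {x}) → Y = A ∩ B ∪ A ∩ C ∪ B ∩ C := by
    rintro Y ⟨a, rfl⟩ ⟨b, rfl⟩ ⟨c, rfl⟩
    have hab : a ≠ b := by rintro rfl; exact hAB rfl
    have hac : a ≠ c := by rintro rfl; exact hAC rfl
    have hbc : b ≠ c := by rintro rfl; exact hBC rfl
    ext x
    simp only [Set.mem_union, Set.mem_inter_iff, Set.mem_symmDiff, Set.mem_singleton_iff]
    grind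
  rw [key Z hA hB hC, key Z' hA' hB' hC']

end SimpleGraph

/-! ### From cut-continuous maps to homomorphisms -/

namespace SimpleGraph

variable {V W : Type*} {G : SimpleGraph V} {H : SimpleGraph W}

/-- If the vertices of `G` can be listed so that any five consecutive ones form a clique, then
cut-continuous maps from `G` come from homomorphisms. -/
theorem CutLE.nonempty_hom (s : ℕ → V) (hs : Function.Surjective s)
    (hadj : ∀ i k, 0 < k → k ≤ 4 → G.Adj (s i) (s (i + k))) (h : G ≼cc H) :
    Nonempty (G →g H) := by
  obtain ⟨g, hg⟩ := h.exists_symmDiff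
  have hdiff (i k l : ℕ) (hkl : k < l) (hlk : l ≤ k + 4) :
      DifferInTwo (g (s (i + k))) (g (s (i + l))) := by
    obtain ⟨a, b, hab, h⟩ := hg _ _ (hadj (i + k) (l - k) (by omega) (by omega))
    rw [show i + k + (l - k) = i + l by omega] at h
    exact ⟨a, b, hab.ne, h⟩
  have hne (i k l : ℕ) (hkl : k < l) (hlk : l ≤ k + 4) : g (s (i + k)) ≠ g (s (i + l)) := by
    intro h
    obtain ⟨p, q, _, h'⟩ := hdiff i k l hkl hlk
    rw [h, symmDiff_self] at h'
    exact (Set.insert_nonempty p {q}).ne_empty h'.symm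
  have hcenter (i : ℕ) : ∃ Z : Set W, ∀ k ≤ 4, ∃ x, g (s (i + k)) = symmDiff Z {x} := by
    obtain ⟨Z, hZ⟩ := exists_center
      (hdiff i 0 1 (by omega) (by omega)) (hdiff i 0 2 (by omega) (by omega))
      (hdiff i 0 3 (by omega) (by omega)) (hdiff i 0 4 (by omega) (by omega))
      (hdiff i 1 2 (by omega) (by omega)) (hdiff i 1 3 (by omega) (by omega))
      (hdiff i 1 4 (by omega) (by omega)) (hdiff i 2 3 (by omega) (by omega))
      (hdiff i 2 4 (by omega) (by omega)) (hdiff i 3 4 (by omega) (by omega))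
    refine ⟨Z, fun k hk => hZ _ ?_⟩
    interval_cases k <;> simp
  choose Z hZ using hcenter
  -- Consecutive windows share four sets, and three already determine the centre.
  have hstep (i : ℕ) : Z (i + 1) = Z i := by
    have hshift (k : ℕ) (hk : k ≤ 4) : ∃ x, g (s (i + (1 + k))) = symmDiff (Z (i + 1)) {x} := by
      rw [← add_assoc]
      exact hZ (i + 1) k hk
    exact center_unique (hne i 1 2 (by omega) (by omega)) (hne i 1 3 (by omega) (by omega))
      (hne i 2 3 (by omega) (by omega)) (hshift 0 (by omega)) (hshift 1 (by omega))
      (hshift 2 (by omega)) (hZ i 1 (by omega)) (hZ i 2 (by omega)) (hZ i 3 (by omega))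
  have hconst (i : ℕ) : Z i = Z 0 := by
    induction i with
    | zero => rfl
    | succ i ih => rw [hstep, ih]
  have hsingle (v : V) : ∃ x, g v = symmDiff (Z 0) {x} := by
    obtain ⟨i, rfl⟩ := hs v
    rw [← hconst i]
    exact hZ i 0 (by omega)
  choose φ hφ using hsingle
  refine ⟨⟨φ, fun {u v} huv => ?_⟩⟩
  obtain ⟨a, b, hab, h⟩ := hg u v huv
  have hne' := hab.ne
  rw [hφ u, hφ v, symmDiff_symmDiff_symmDiff_comm, symmDiff_self, bot_symmDiff] at h
  have h' := Set.ext_iff.1 h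
  simp only [Set.mem_symmDiff, Set.mem_insert_iff, Set.mem_singleton_iff] at h'
  have : (φ u = a ∧ φ v = b) ∨ (φ u = b ∧ φ v = a) := by
    have h1 := h' (φ u)
    have h2 := h' (φ v)
    have h3 := h' a
    have h4 := h' b
    clear h h' hg hdiff hne hZ hstep hconst hφ hs hadj
    grind
  rcases this with ⟨h1, h2⟩ | ⟨h1, h2⟩
  · rwa [h1, h2]
  · rw [h1, h2]
    exact hab.symm

/-! ### Jump cycles and their homomorphisms -/

/-- The signed differences of the graphs `jumpCycle n`. -/
def jumps : List ℤ := [-10, -4, -3, -2, -1, 1, 2, 3, 4, 10]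

/-- The circulant graph on `ZMod n` in which vertices at distance `1`, `2`, `3`, `4` or `10`
are adjacent. -/
def jumpCycle (n : ℕ) : SimpleGraph (ZMod n) :=
  circulantGraph {x | ∃ d ∈ jumps, (d : ZMod n) = x}

theorem neg_mem_jumps {d : ℤ} (hd : d ∈ jumps) : -d ∈ jumps := by
  simp only [jumps, List.mem_cons, List.not_mem_nil, or_false] at *
  omega

theorem abs_le_of_mem_jumps {d : ℤ} (hd : d ∈ jumps) : |d| ≤ 10 := by
  simp only [jumps, List.mem_cons, List.not_mem_nil, or_false] at hd
  rw [abs_le]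
  omega

theorem jumpCycle_adj_iff {n : ℕ} {x y : ZMod n} :
    (jumpCycle n).Adj x y ↔ x ≠ y ∧ ∃ d ∈ jumps, y = x + d := by
  simp only [jumpCycle, circulantGraph_adj, Set.mem_ofPred_eq]
  refine and_congr_right fun _ => ⟨?_, ?_⟩
  · rintro (⟨d, hd, h⟩ | ⟨d, hd, h⟩)
    · exact ⟨-d, neg_mem_jumps hd, by rw [Int.cast_neg, h]; ring⟩
    · exact ⟨d, hd, by rw [h]; ring⟩
  · rintro ⟨d, hd, h⟩
    exact Or.inr ⟨d, hd, by rw [h]; ring⟩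

theorem int_eq_of_cast_eq {m : ℕ} {a b : ℤ} (hab : |a - b| < m) (h : (a : ZMod m) = b) :
    a = b := by
  rw [ZMod.intCast_eq_intCast_iff_dvd_sub] at h
  have := Int.eq_zero_of_abs_lt_dvd h (by rwa [abs_sub_comm])
  omega

theorem jumpCycle_adj_add {n : ℕ} (hn : 200 < n) (x : ZMod n) {d : ℤ} (hd : d ∈ jumps) :
    (jumpCycle n).Adj x (x + d) := by
  refine jumpCycle_adj_iff.2 ⟨fun h => ?_, d, hd, rfl⟩
  have h0 : ((d : ℤ) : ZMod n) = (0 : ℤ) := by simpa using h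
  have := int_eq_of_cast_eq (by have := abs_le_of_mem_jumps hd; rw [sub_zero]; omega) h0
  subst this
  simp [jumps] at hd

/-- For large `n` and `m`, homomorphisms between jump cycles are given by divisibility. -/
theorem nonempty_jumpCycle_hom_iff {n m : ℕ} (hn : 200 < n) (hm : 200 < m) :
    Nonempty (jumpCycle n →g jumpCycle m) ↔ m ∣ n := by
  constructor
  · rintro ⟨φ⟩
    have hstep (x : ZMod n) (k : ℤ) (hk : k ∈ jumps) : ∃ d ∈ jumps, φ (x + k) = φ x + d :=
      (jumpCycle_adj_iff.1 (φ.map_adj (jumpCycle_adj_add hn x hk))).2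
    have h1 : (1 : ℤ) ∈ jumps := by simp [jumps]
    choose! d hd hφ using fun i : ℕ => hstep i 1 h1
    have hsucc (i : ℕ) : φ ((i + 1 : ℕ) : ZMod n) = φ (i : ZMod n) + d i := by
      rw [← hφ i]; push_cast; rfl
    have hsum (i k : ℕ) :
        φ ((i + k : ℕ) : ZMod n) = φ (i : ZMod n) + ((∑ j ∈ Finset.range k, d (i + j) : ℤ)) := by
      induction k with
      | zero => simp
      | succ k ih =>
        rw [← add_assoc, hsucc, ih, Finset.sum_range_succ]
        push_cast
        ring
    have hmem (i k : ℕ) (hk : (k : ℤ) ∈ jumps) : ∑ j ∈ Finset.range k, d (i + j) ∈ jumps := by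
      obtain ⟨e, he, h⟩ := hstep i k hk
      have hk' : |(k : ℤ)| ≤ 10 := abs_le_of_mem_jumps hk
      have hsum' := hsum i k
      push_cast at hsum' h
      rw [h] at hsum'
      -- At most ten steps of size at most 10: the sum and `e` differ by at most 110, less than `m`,
      -- so their congruence is an equality.
      have hle : |∑ j ∈ Finset.range k, d (i + j)| ≤ 100 := by
        calc _ ≤ ∑ j ∈ Finset.range k, |d (i + j)| := Finset.abs_sum_le_sum_abs _ _
          _ ≤ ∑ j ∈ Finset.range k, 10 := Finset.sum_le_sum fun j _ => abs_le_of_mem_jumps (hd _)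
          _ ≤ 100 := by
            simp only [Finset.sum_const, Finset.card_range, nsmul_eq_mul]
            rw [abs_le] at hk'
            omega
      have he' := abs_le_of_mem_jumps he
      have heq : e = ∑ j ∈ Finset.range k, d (i + j) := by
        refine int_eq_of_cast_eq (m := m) ?_ ?_
        · rw [abs_le] at hle he'
          rw [abs_lt]
          omega
        · push_cast
          exact add_left_cancel hsum'
      rwa [← heq]
    have hrun (i : ℕ) : d i = d (i + 1) ∧ (d i = 1 ∨ d i = -1) := by
      have m1 (i : ℕ) : d i ∈ jumps := hd i
      have m2 (i : ℕ) : d i + d (i + 1) ∈ jumps := by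
        simpa [Finset.sum_range_succ] using hmem i 2 (by simp [jumps])
      have m3 (i : ℕ) : d i + d (i + 1) + d (i + 2) ∈ jumps := by
        simpa [Finset.sum_range_succ] using hmem i 3 (by simp [jumps])
      have m4 (i : ℕ) : d i + d (i + 1) + d (i + 2) + d (i + 3) ∈ jumps := by
        simpa [Finset.sum_range_succ] using hmem i 4 (by simp [jumps])
      have m10 : _ ∈ jumps := hmem i 10 (by simp [jumps])
      simp only [Finset.sum_range_succ, Finset.sum_range_zero, zero_add, add_zero] at m10
      exact steps_eq_of_sums_mem jumps rfl
        _ (m1 i) _ (m1 (i + 1)) (m2 i) _ (m1 (i + 2)) (m2 (i + 1)) (m3 i)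
        _ (m1 (i + 3)) (m2 (i + 2)) (m3 (i + 1)) (m4 i)
        _ (m1 (i + 4)) (m2 (i + 3)) (m3 (i + 2)) (m4 (i + 1))
        _ (m1 (i + 5)) (m2 (i + 4)) (m3 (i + 3)) (m4 (i + 2))
        _ (m1 (i + 6)) (m2 (i + 5)) (m3 (i + 4)) (m4 (i + 3))
        _ (m1 (i + 7)) (m2 (i + 6)) (m3 (i + 5)) (m4 (i + 4))
        _ (m1 (i + 8)) (m2 (i + 7)) (m3 (i + 6)) (m4 (i + 5))
        _ (m1 (i + 9)) (m2 (i + 8)) (m3 (i + 7)) (m4 (i + 6)) m10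
    have hconst (i : ℕ) : d i = d 0 := by
      induction i with
      | zero => rfl
      | succ i ih => rw [← (hrun i).1, ih]
    -- After `n` equal steps `±1` the walk closes up modulo `m`.
    have hn0 := hsum 0 n
    simp only [zero_add, hconst, Finset.sum_const, Finset.card_range, CharP.cast_eq_zero,
      nsmul_eq_mul, left_eq_add, Nat.cast_zero] at hn0
    rcases (hrun 0).2 with h | h <;>
    · rw [h] at hn0
      rw [← ZMod.natCast_eq_zero_iff]
      simpa using hn0
  · intro h
    refine ⟨⟨ZMod.castHom h (ZMod m), fun {x y} hxy => ?_⟩⟩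
    obtain ⟨-, d, hd, rfl⟩ := jumpCycle_adj_iff.1 hxy
    rw [map_add, map_intCast]
    exact jumpCycle_adj_add hm _ hd

theorem nonempty_hom_of_jumpCycle_cutLE {n : ℕ} (hn : 200 < n) (h : jumpCycle n ≼cc H) :
    Nonempty (jumpCycle n →g H) := by
  have : NeZero n := ⟨by omega⟩
  refine h.nonempty_hom (fun i : ℕ => (i : ZMod n))
    (fun x => ⟨x.val, ZMod.natCast_zmod_val x⟩) fun i k hk hk' => ?_
  have := jumpCycle_adj_add hn (i : ZMod n) (d := k) (by simp only [jumps]; interval_cases k <;> simp)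
  simpa using this

end SimpleGraph

/-! ### Disjoint unions -/

namespace SimpleGraph

/-- The disjoint union of a family of graphs. -/
def disjointUnion {ι : Type*} {V : ι → Type*} (G : ∀ i, SimpleGraph (V i)) :
    SimpleGraph (Σ i, V i) where
  Adj x y := ∃ i u v, x = ⟨i, u⟩ ∧ y = ⟨i, v⟩ ∧ (G i).Adj u v
  symm := ⟨by
    rintro _ _ ⟨i, u, v, rfl, rfl, h⟩
    exact ⟨i, v, u, rfl, rfl, h.symm⟩⟩
  loopless := ⟨by
    rintro _ ⟨i, u, v, rfl, h, huv⟩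
    cases h
    exact huv.ne rfl⟩

section disjointUnion

variable {ι : Type*} {V : ι → Type*} {G : ∀ i, SimpleGraph (V i)}

/-- The inclusion of a summand into a disjoint union. -/
def disjointUnionInclusion (G : ∀ i, SimpleGraph (V i)) (i : ι) : G i →g disjointUnion G where
  toFun u := ⟨i, u⟩
  map_rel' h := ⟨i, _, _, rfl, rfl, h⟩

theorem nonempty_disjointUnion_hom {W : Type*} {H : SimpleGraph W}
    (h : ∀ i, Nonempty (G i →g H)) : Nonempty (disjointUnion G →g H) := by
  let φ := fun i => (h i).some
  refine ⟨⟨fun x => φ x.1 x.2, ?_⟩⟩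
  rintro _ _ ⟨i, u, v, rfl, rfl, h⟩
  exact (φ i).map_adj h

theorem fst_eq_of_disjointUnion_adj {x y : Σ i, V i} (h : (disjointUnion G).Adj x y) :
    x.1 = y.1 := by
  obtain ⟨i, u, v, rfl, rfl, -⟩ := h
  rfl

theorem exists_nonempty_hom_summand {W : Type*} {F : SimpleGraph W} (hF : F.Connected)
    (φ : F →g disjointUnion G) : ∃ i, Nonempty (F →g G i) := by
  obtain ⟨w⟩ := hF.nonempty
  have hfst (v : W) : (φ v).1 = (φ w).1 := by
    obtain ⟨p⟩ := hF.preconnected v w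
    induction p with
    | nil => rfl
    | cons h _ ih => exact (fst_eq_of_disjointUnion_adj (φ.map_adj h)).trans ih
  have : ∀ v, ∃ u, φ v = ⟨(φ w).1, u⟩ := fun v => ⟨hfst v ▸ (φ v).2, by
    ext
    · exact hfst v
    · simp⟩
  choose ψ hψ using this
  refine ⟨_, ⟨⟨ψ, fun {u v} huv => ?_⟩⟩⟩
  have h := φ.map_adj huv
  rw [hψ u, hψ v] at h
  obtain ⟨i, a, b, ha, hb, hab⟩ := h
  cases ha
  cases hb
  exact hab

end disjointUnion

theorem jumpCycle_connected {n : ℕ} (hn : 200 < n) : (jumpCycle n).Connected := by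
  have : NeZero n := ⟨by omega⟩
  have h (i : ℕ) : (jumpCycle n).Reachable 0 (i : ZMod n) := by
    induction i with
    | zero => simp
    | succ i ih =>
      have := jumpCycle_adj_add hn (i : ZMod n) (d := 1) (by simp [jumps])
      refine ih.trans (Adj.reachable ?_)
      simpa using this
  have h' (x : ZMod n) : (jumpCycle n).Reachable 0 x := by
    simpa using h x.val
  exact ⟨fun x y => (h' x).symm.trans (h' y)⟩

/-- Between disjoint unions of large jump cycles, the cut-continuous order is the domination
order of the sets of lengths with respect to divisibility. -/
theorem disjointUnion_jumpCycle_cutLE_iff {ι κ : Type*} {M : ι → ℕ} {N : κ → ℕ}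
    (hM : ∀ i, 200 < M i) (hN : ∀ j, 200 < N j) :
    disjointUnion (fun i => jumpCycle (M i)) ≼cc disjointUnion (fun j => jumpCycle (N j)) ↔
      ∀ i, ∃ j, N j ∣ M i := by
  constructor
  · intro h i
    have hi := (disjointUnionInclusion (fun i => jumpCycle (M i)) i).cutLE.trans h
    obtain ⟨φ⟩ := nonempty_hom_of_jumpCycle_cutLE (hM i) hi
    obtain ⟨j, hj⟩ := exists_nonempty_hom_summand (jumpCycle_connected (hM i)) φ
    exact ⟨j, (nonempty_jumpCycle_hom_iff (hM i) (hN j)).1 hj⟩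
  · intro h
    obtain ⟨φ⟩ := nonempty_disjointUnion_hom (G := fun i => jumpCycle (M i))
      (H := disjointUnion fun j => jumpCycle (N j)) fun i => by
        obtain ⟨j, hj⟩ := h i
        obtain ⟨ψ⟩ := (nonempty_jumpCycle_hom_iff (hM i) (hN j)).2 hj
        exact ⟨(disjointUnionInclusion (fun j => jumpCycle (N j)) j).comp ψ⟩
    exact φ.cutLE

end SimpleGraph

/-! ### Coding a countable order by divisibility -/

open Classical in
/-- The product, over the `k ≤ i` above `i`, of the `k`-th prime, times a large constant. -/
noncomputable def upperCode (R : ℕ → ℕ → Prop) (i : ℕ) : ℕ :=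
  201 * ∏ k ∈ Finset.range (i + 1) with R i k, Nat.nth Nat.Prime k

theorem upperCode_large (R : ℕ → ℕ → Prop) (i : ℕ) : 200 < upperCode R i := by
  classical
  have : 0 < ∏ k ∈ Finset.range (i + 1) with R i k, Nat.nth Nat.Prime k :=
    Finset.prod_pos fun k _ => (Nat.prime_nth_prime k).pos
  have h : upperCode R i = 201 * ∏ k ∈ Finset.range (i + 1) with R i k, Nat.nth Nat.Prime k := by
    unfold upperCode
    congr!
  omega

theorem upperCode_dvd_iff (R : ℕ → ℕ → Prop) (i j : ℕ) :
    upperCode R j ∣ upperCode R i ↔ ∀ k ≤ j, R j k → k ≤ i ∧ R i k := by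
  classical
  unfold upperCode
  rw [Nat.mul_dvd_mul_iff_left (by norm_num)]
  constructor
  · intro h k hk hjk
    have hp := Nat.prime_nth_prime k
    have hk' : Nat.nth Nat.Prime k ∣ ∏ k ∈ Finset.range (i + 1) with R i k, Nat.nth Nat.Prime k :=
      (Finset.dvd_prod_of_mem (Nat.nth Nat.Prime) (Finset.mem_filter.2
        ⟨Finset.mem_range.2 (Nat.lt_succ_of_le hk), hjk⟩)).trans h
    obtain ⟨l, hl, hkl⟩ := (hp.prime.dvd_finsetProd_iff _).1 hk'
    have := Nat.nth_injective Nat.infinite_setOfPred_prime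
      ((Nat.prime_dvd_prime_iff_eq hp (Nat.prime_nth_prime l)).1 hkl)
    subst this
    simp only [Finset.mem_filter, Finset.mem_range] at hl
    exact ⟨by omega, hl.2⟩
  · intro h
    refine Finset.prod_dvd_prod_of_subset _ _ _ fun k hk => ?_
    simp only [Finset.mem_filter, Finset.mem_range] at hk ⊢
    have := h k (by omega) hk.2
    exact ⟨by omega, this.2⟩

/-- A transitive relation on `ℕ` is coded, at its reflexive points, by the domination order of
finite sets of numbers with respect to divisibility. -/
theorem forall_exists_upperCode_dvd_iff {R : ℕ → ℕ → Prop} (hR : ∀ i j k, R i j → R j k → R i k)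
    (hR' : ∀ i j, R i j → R i i)
    {n m : ℕ} (hn : R n n) (hm : R m m) :
    (∀ i : {i // i ≤ n ∧ R i n}, ∃ j : {j // j ≤ m ∧ R j m},
      upperCode R j ∣ upperCode R i) ↔ R n m := by
  simp only [upperCode_dvd_iff]
  constructor
  · intro h
    obtain ⟨⟨j, hjm, hj⟩, h⟩ := h ⟨n, le_rfl, hn⟩
    -- By reflexivity at `j`, the `j`-th prime divides the code of `j`, hence that of `n`.
    exact hR _ _ _ (h j le_rfl (hR' _ _ hj)).2 hj
  · rintro h ⟨i, hin, hi⟩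
    by_cases him : i ≤ m
    · exact ⟨⟨i, him, hR _ _ _ hi h⟩, fun k hk hik => ⟨hk, hik⟩⟩
    -- When `i` exceeds `m` it is no longer available, but `m` serves: its code uses only primes of
    -- index at most `m`.
    · exact ⟨⟨m, le_rfl, hm⟩, fun k hk hmk => ⟨by simp only at *; omega,
        hR _ _ _ hi (hR _ _ _ h hmk)⟩⟩

theorem mainTheorem5 (P : Type*) [PartialOrder P] [Countable P] :
    ∃ (V : P → Type) (_ : ∀ p, Finite (V p)) (G : ∀ p, SimpleGraph (V p)),
      ∀ p q : P, (p < q ↔ G p ≺cc G q) ∧ (p ≤ q ↔ G p ≼cc G q) := by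
  obtain ⟨f, hf⟩ := Countable.exists_injective_nat P
  let R : ℕ → ℕ → Prop := fun i j => ∃ p q, f p = i ∧ f q = j ∧ p ≤ q
  have hR : ∀ i j k, R i j → R j k → R i k := by
    rintro _ _ _ ⟨p, q, rfl, rfl, hpq⟩ ⟨q', r, hq, rfl, hqr⟩
    obtain rfl := hf hq
    exact ⟨p, r, rfl, rfl, hpq.trans hqr⟩
  have hR' : ∀ i j, R i j → R i i := by
    rintro _ _ ⟨p, q, rfl, rfl, hpq⟩
    exact ⟨p, p, rfl, rfl, le_rfl⟩
  have hRf (p q : P) : R (f p) (f q) ↔ p ≤ q := by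
    constructor
    · rintro ⟨p', q', hp, hq, h⟩
      rwa [← hf hp, ← hf hq]
    · exact fun h => ⟨p, q, rfl, rfl, h⟩
  -- Only the part of the down-set of `p` enumerated up to `p` is used, which keeps the graphs
  -- finite.
  let I (p : P) : Type := {i : ℕ // i ≤ f p ∧ R i (f p)}
  have hI (p : P) : Finite (I p) :=
    ((Set.finite_Iic (f p)).subset fun i (hi : i ≤ f p ∧ R i (f p)) => hi.1).to_subtype
  have hle (p q : P) : p ≤ q ↔
      SimpleGraph.disjointUnion (fun i : I p => SimpleGraph.jumpCycle (upperCode R i.1)) ≼cc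
      SimpleGraph.disjointUnion (fun i : I q => SimpleGraph.jumpCycle (upperCode R i.1)) := by
    rw [SimpleGraph.disjointUnion_jumpCycle_cutLE_iff (fun _ => upperCode_large R _)
      (fun _ => upperCode_large R _), ← hRf p q]
    exact (forall_exists_upperCode_dvd_iff hR hR' ((hRf p p).2 le_rfl) ((hRf q q).2 le_rfl)).symm
  refine ⟨fun p => Σ i : I p, ZMod (upperCode R i.1), fun p => ?_, fun p =>
    SimpleGraph.disjointUnion fun i : I p => SimpleGraph.jumpCycle (upperCode R i.1),
    fun p q => ⟨?_, hle p q⟩⟩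
  · have (i : I p) : NeZero (upperCode R i.1) := ⟨by have := upperCode_large R i.1; omega⟩
    infer_instance
  · rw [lt_iff_le_not_ge, hle p q, hle q p]
    rfl
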